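/- **Setting.** Let $\mathcal X_1,\dots,\mathcal X_n\in\mathbb R^{I_1\times\cdots\times I_N}$ be input tensors with labels $y_1,\dots,y_n\in\mathbb R^c$, let $\theta\in\mathbb R^p$ denote the weights of a model with output features $f_\theta(\mathcal X_i)\in\mathbb R^c$, let $f_\theta(\mathcal X)\in\mathbb R^{n\times c}$ be the matrix with rows $f_\theta(\mathcal X_i)$, and let $X_{(1)}\in\mathbb R^{n\times m}$, $m=\prod_k I_k$, be the matrix whose $i$-th row is the vectorization of $\mathcal X_i$. For a loss function $l$ put $L(\theta)=\frac1n\sum_{i=1}^n l(f_\theta(\mathcal X_i),y_i)$, and assume that $\theta\mapsto f_\theta(\mathcal X)$ and $L$ are continuous. Write $\|X_{(1)},\xi\|_*$ for the nuclear norm (sum of singular values) of the concatenated matrix $[X_{(1)},\xi]$. For $\lambda,\mu>0$ define, for $(\theta,\xi)\in\mathbb R^p\times\mathbb R^{n\times c}$, $$\mathcal L(\theta,\xi)=L(\theta)+\lambda\|X_{(1)},\xi\|_*+\frac{\mu}{2}\|f_\theta(\mathcal X)-\xi\|_F^2 .$$ **Notions.** For $h:\mathbb R^d\to\mathbb R$,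 a regular subgradient of $h$ at $x$ is a $v$ with $h(y)\ge h(x)+\langle v,y-x\rangle+o(\|y-x\|)$ as $y\to x$; the subdifferential $\partial h(x)$ consists of the limits of regular subgradients $v_j$ at points $x_j\to x$ with $h(x_j)\to h(x)$; $x$ is a critical point if $0\in\partial h(x)$. The function $h$ is regular at $x$ if its epigraph $\{(y,r): h(y)\le r\}$ is Clarke regular at $(x,h(x))$, i.e. locally closed there, with every limiting normal a regular (Fréchet) normal. It has the Kurdyka–Łojasiewicz property if for every $\bar x$ with $\partial h(\bar x)\neq\emptyset$ there are $\eta>0$, a neighbourhood $U$ of $\bar x$ and a continuous concave $\varphi$ on $[0,\eta)$ with $\varphi(0)=0$, $\varphi\in C^1(0,\eta)$, $\varphi'>0$ on $(0,\eta)$, such that $\varphi'(h(x)-h(\bar x))\,\mathrm{dist}(0,\partial h(x))\ge 1$ for all $x\in U$ with $h(\bar x)<h(x)<h(\bar x)+\eta$ (where $\mathrm{dist}(0,\emptyset)=+\infty$). **Assumptions.** (i) $\mathcal L$ is regular at every point and has the Kurdyka–Łojasiewicz property. (ii) The subgradients of $f_\theta(\mathcal X)$ are bounded: there is $\rho>0$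 such that $\|g\|\le\rho$ for all $\theta$, all $i,j$ and all $g\in\partial_\theta\,(f_\theta(\mathcal X))_{ij}$. **Algorithm (alternating minimization).** Start from an arbitrary $\theta^0$ and $\xi^0=0$. For $k\ge 0$, * $\theta^{k+1}$ solves the nonconvex problem $\min_\theta\, q_k(\theta):=L(\theta)+\frac\mu2\|f_\theta(\mathcal X)-\xi^k\|_F^2$ in the sense that $0\in\partial q_k(\theta^{k+1})$ and $q_k(\theta^{k+1})\le q_k(\theta^k)$ (in particular, any global minimizer is admissible); * $\xi^{k+1}$ is the minimizer of the convex problem $\min_\xi\,\lambda\|X_{(1)},\xi\|_*+\frac\mu2\|f_{\theta^{k+1}}(\mathcal X)-\xi\|_F^2$. **Theorem.** Suppose (i) and (ii) hold, and let $\{(\theta^k,\xi^k)\}_{k\ge0}$ be generated by the algorithm, with $\{\theta^k\}$ bounded. Then $\{\xi^k\}$ has finite length, $\sum_{k\ge0}\|\xi^{k+1}-\xi^k\|_F<\infty$, and the whole sequence converges to some $\xi^*$. Moreover, for every limit point $\theta^*$ of $\{\theta^k\}$, the pair $(\theta^*,\xi^*)$ is a critical point of $\mathcal L$. -/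

import Mathlib

open Filter Topology Set
open scoped RealInnerProductSpace

noncomputable section

namespace CoupledNorm

/-! ### Variational analysis in Euclidean spaces -/

section Variational

variable {E : Type*} [NormedAddCommGroup E] [InnerProductSpace ℝ E]

/-- The regular (Fréchet) normal cone of `C` at `x`. -/
def regularNormalCone (C : Set E) (x : E) : Set E :=
  {v | x ∈ C ∧ ∀ ε > 0, ∀ᶠ y in 𝓝[C] x, ⟪v, y - x⟫ ≤ ε * ‖y - x‖}

/-- The limiting (Mordukhovich) normal cone of `C` at `x`. -/
def normalCone (C : Set E) (x : E) : Set E :=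
  {v | x ∈ C ∧ ∃ (y : ℕ → E) (w : ℕ → E), (∀ j, w j ∈ regularNormalCone C (y j)) ∧
    Tendsto y atTop (𝓝 x) ∧ Tendsto w atTop (𝓝 v)}

/-- Clarke regularity of a set at one of its points: `C` is locally closed at `x` and every
limiting normal is a regular normal. -/
def ClarkeRegularAt (C : Set E) (x : E) : Prop :=
  x ∈ C ∧ (∃ r > 0, IsClosed (C ∩ Metric.closedBall x r)) ∧
    normalCone C x = regularNormalCone C x

/-- The epigraph of `f`, as a subset of the Euclidean product `E × ℝ`. -/
def epigraph (f : E → ℝ) : Set (WithLp 2 (E × ℝ)) :=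
  {z | f z.fst ≤ z.snd}

/-- `f` is regular at `x` if its epigraph is Clarke regular at `(x, f x)`. -/
def RegularAt (f : E → ℝ) (x : E) : Prop :=
  ClarkeRegularAt (epigraph f) (WithLp.toLp 2 (x, f x))

/-- The regular (Fréchet) subdifferential:
`f y ≥ f x + ⟪v, y - x⟫ + o(‖y - x‖)` as `y → x`. -/
def regularSubdiff (f : E → ℝ) (x : E) : Set E :=
  {v | ∀ ε > 0, ∀ᶠ y in 𝓝 x, f x + ⟪v, y - x⟫ - ε * ‖y - x‖ ≤ f y}

/-- The (limiting) subdifferential `∂f(x)`: limits of regular subgradients at points `y j`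
with `y j → x` and `f (y j) → f x`. -/
def subdiff (f : E → ℝ) (x : E) : Set E :=
  {v | ∃ (y : ℕ → E) (w : ℕ → E), (∀ j, w j ∈ regularSubdiff f (y j)) ∧
    Tendsto y atTop (𝓝 x) ∧ Tendsto (fun j => f (y j)) atTop (𝓝 (f x)) ∧
    Tendsto w atTop (𝓝 v)}

/-- `x` is a critical point of `f` if `0 ∈ ∂f(x)`. -/
def IsCritical (f : E → ℝ) (x : E) : Prop := (0 : E) ∈ subdiff f x

/-- A global minimizer is a critical point. -/
theorem isCritical_of_forall_le {f : E → ℝ} {x : E} (h : ∀ y, f x ≤ f y) : IsCritical f x := by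
  refine ⟨fun _ => x, fun _ => 0, fun _ ε hε => Eventually.of_forall fun y => ?_,
    tendsto_const_nhds, tendsto_const_nhds, tendsto_const_nhds⟩
  have h1 : 0 ≤ ε * ‖y - x‖ := mul_nonneg (le_of_lt hε) (norm_nonneg _)
  have h2 := h y
  simp only [inner_zero_left]
  linarith

/-- Desingularizing functions on `[0, η)`. -/
structure IsDesingularizing (η : ℝ) (φ : ℝ → ℝ) : Prop where
  map_zero : φ 0 = 0
  continuousOn : ContinuousOn φ (Ico 0 η)
  concaveOn : ConcaveOn ℝ (Ico 0 η) φ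
  contDiffOn : ContDiffOn ℝ 1 φ (Ioo 0 η)
  deriv_pos : ∀ s ∈ Ioo 0 η, 0 < deriv φ s

/-- The Kurdyka–Łojasiewicz property at `x`:
`φ'(f u - f x) * dist(0, ∂f(u)) ≥ 1` for all `u` near `x` with `f x < f u < f x + η`.
The distance is written out over the elements of `∂f(u)`, so that it is `+∞` if `∂f(u) = ∅`. -/
def KLAt (f : E → ℝ) (x : E) : Prop :=
  ∃ η > 0, ∃ φ : ℝ → ℝ, IsDesingularizing η φ ∧
    ∀ᶠ u in 𝓝 x, f x < f u → f u < f x + η →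
      ∀ v ∈ subdiff f u, 1 ≤ deriv φ (f u - f x) * ‖v‖

/-- `f` has the Kurdyka–Łojasiewicz property: it holds at every point of `dom ∂f`. -/
def KLProperty (f : E → ℝ) : Prop :=
  ∀ x, (subdiff f x).Nonempty → KLAt f x

end Variational

/-! ### The regularized model -/

/-- The nuclear norm of a real matrix: the sum of its singular values. -/
def nuclearNorm {m n : Type*} [Fintype m] [Fintype n] [DecidableEq n] (A : Matrix m n ℝ) : ℝ :=
  (Matrix.toEuclideanLin A).singularValues.sum fun _ σ => σ

/-- Real tensors of size `I 0 × ⋯ × I (N - 1)`. -/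
abbrev Tensor {N : ℕ} (I : Fin N → ℕ) : Type := ((k : Fin N) → Fin (I k)) → ℝ

/-- Network parameters, with the Euclidean norm. -/
abbrev Params (p : ℕ) : Type := EuclideanSpace ℝ (Fin p)

/-- Real `n × c` matrices, with the Frobenius norm. -/
abbrev Feat (n c : ℕ) : Type := EuclideanSpace ℝ (Fin n × Fin c)

/-- The Euclidean space of pairs `(θ, ξ)`. -/
abbrev Joint (p n c : ℕ) : Type := WithLp 2 (Params p × Feat n c)

/-- The data of the training problem: `n` samples with labels, a parametrized model `f`
(`f θ x` is the output feature of the input `x`), a loss function `loss` (first argument: the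
output feature, second argument: the label) and the two hyperparameters. -/
structure Problem {N : ℕ} (I : Fin N → ℕ) (n c p : ℕ) where
  X : Fin n → Tensor I
  Y : Fin n → Fin c → ℝ
  f : Params p → Tensor I → Fin c → ℝ
  loss : (Fin c → ℝ) → (Fin c → ℝ) → ℝ
  lam : ℝ
  mu : ℝ

namespace Problem

variable {N : ℕ} {I : Fin N → ℕ} {n c p : ℕ} (P : Problem I n c p)

/-- `X₍₁₎`: the unfolding of the data tensor along the sample mode. Its columns are indexed by the
multi-indices of the input tensors. -/
def unfolding : Matrix (Fin n) ((k : Fin N) → Fin (I k)) ℝ :=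
  Matrix.of fun i a => P.X i a

/-- The matrix `f_θ(𝒳)` of the output features of all samples. -/
def features (θ : Params p) : Feat n c :=
  WithLp.toLp 2 fun ij => P.f θ (P.X ij.1) ij.2

/-- The empirical loss `L(θ)`. -/
def empiricalLoss (θ : Params p) : ℝ :=
  (1 / (n : ℝ)) * ∑ i, P.loss (P.f θ (P.X i)) (P.Y i)

/-- `‖X₍₁₎, ξ‖_*`: the nuclear norm of the concatenated matrix `[X₍₁₎, ξ]`. -/
def coupledNorm (ξ : Feat n c) : ℝ :=
  nuclearNorm (Matrix.fromCols P.unfolding (Matrix.of fun i j => ξ (i, j)))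

/-- The penalized objective `ℒ(θ, ξ)`. -/
def objective (u : Joint p n c) : ℝ :=
  P.empiricalLoss u.fst + P.lam * P.coupledNorm u.snd
    + P.mu / 2 * ‖P.features u.fst - u.snd‖ ^ 2

/-- The objective of the `θ`-subproblem for fixed `ξ`. -/
def thetaObjective (ξ : Feat n c) (θ : Params p) : ℝ :=
  P.empiricalLoss θ + P.mu / 2 * ‖P.features θ - ξ‖ ^ 2

/-- The objective of the `ξ`-subproblem for fixed `θ`. -/
def xiObjective (θ : Params p) (ξ : Feat n c) : ℝ :=
  P.lam * P.coupledNorm ξ + P.mu / 2 * ‖P.features θ - ξ‖ ^ 2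

/-- `θ'` solves the nonconvex `θ`-subproblem starting from `θ`: it is a critical point of the
subproblem and does not increase its objective. Every global minimizer qualifies
(`solvesTheta_of_forall_le`). -/
def SolvesTheta (ξ : Feat n c) (θ θ' : Params p) : Prop :=
  P.thetaObjective ξ θ' ≤ P.thetaObjective ξ θ ∧ IsCritical (P.thetaObjective ξ) θ'

theorem solvesTheta_of_forall_le {ξ : Feat n c} {θ' : Params p}
    (h : ∀ τ, P.thetaObjective ξ θ' ≤ P.thetaObjective ξ τ) (θ : Params p) :
    P.SolvesTheta ξ θ θ' :=
  ⟨h θ, isCritical_of_forall_le h⟩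

/-- The sequences `θ`, `ξ` are generated by the alternating minimization method: `ξ⁰ = 0`,
`θ⁰` is arbitrary, `θᵏ⁺¹` solves the `θ`-subproblem at `ξᵏ`, and `ξᵏ⁺¹` is the minimizer of the
(strongly convex) `ξ`-subproblem at `θᵏ⁺¹`. -/
structure IsAlternatingMinimization (θ : ℕ → Params p) (ξ : ℕ → Feat n c) : Prop where
  xi_zero : ξ 0 = 0
  theta_step : ∀ k, P.SolvesTheta (ξ k) (θ k) (θ (k + 1))
  xi_step : ∀ k, ∀ ζ, P.xiObjective (θ (k + 1)) (ξ (k + 1)) ≤ P.xiObjective (θ (k + 1)) ζ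

end Problem

end CoupledNorm

end

/-!
The method is an alternating descent whose second block is strongly convex, and the proof is the
Kurdyka–Łojasiewicz argument for descent sequences, run with the step sizes `‖ξᵏ⁺¹ - ξᵏ‖` alone;
nothing is needed about the distances of successive `θᵏ`.

*Decrease.* The nuclear norm is convex: the pairing with the partial isometry of the polar
decomposition is a supporting linear functional (`exists_supporting_singularValues`). Hence the
`ξ`-subproblem grows quadratically at its minimizer, and each iteration lowers `ℒ` by a multiple of
`‖ξᵏ⁺¹ - ξᵏ‖²` (`objective_succ_add_le`).

*Subgradients.* A continuous function with bounded subgradients is Lipschitz on bounded sets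
(`exists_lipschitz_of_regularSubdiff_bounded`), so the features are. The objectives of the
`θ`-subproblems for `ξᵏ` and `ξᵏ⁺¹` therefore differ by a function whose Lipschitz constant is a
multiple of `‖ξᵏ⁺¹ - ξᵏ‖`, and by a sum rule (`exists_subdiff_norm_le_of_isCritical_add`) the
latter has at `θᵏ⁺¹` a subgradient `v` of that size. The pair `(v, 0)` is a subgradient of `ℒ` at
`(θᵏ⁺¹, ξᵏ⁺¹)`: up to a sum of functions of `θ` and of `ξ`, the objective is the coupling term
`-μ ⟪f_θ(𝒳) - f_θ'(𝒳), ξ - ξ'⟫`, which is of second order at `(θ', ξ')` because the features are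
Lipschitz (`toLp_mem_regularSubdiff_objective`).

*Finite length.* The iterates are bounded, so their cluster points are critical points of `ℒ` with
the same value, and one desingularizing function serves the whole tail of the sequence
(`exists_isDesingularizing_of_descent`). Its concavity makes the step sizes summable
(`summable_of_descent`). Limits of `(θᵏ, ξᵏ)` along subsequences are critical because the graph of
the subdifferential is closed (`mem_subdiff_of_tendsto`).
-/

namespace CoupledNorm

/-! ### Convexity of the nuclear norm -/

section SingularValues

variable {E F : Type*} [NormedAddCommGroup E] [InnerProductSpace ℝ E] [FiniteDimensional ℝ E]
  [NormedAddCommGroup F] [InnerProductSpace ℝ F] [FiniteDimensional ℝ F]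

/-- Right singular vectors: an orthonormal eigenbasis of `T* T`. -/
theorem exists_orthonormalBasis_singularValues (T : E →ₗ[ℝ] F) :
    ∃ e : OrthonormalBasis (Fin (Module.finrank ℝ E)) ℝ E,
      (∀ i j, i ≠ j → ⟪T (e i), T (e j)⟫ = 0) ∧
      T.singularValues.sum (fun _ σ => σ) = ∑ i, ‖T (e i)‖ := by
  set hT := T.isSymmetric_adjoint_comp_self
  set e := hT.eigenvectorBasis rfl
  have hin : ∀ i j, ⟪T (e i), T (e j)⟫ = hT.eigenvalues rfl j * ⟪e i, e j⟫ := by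
    intro i j
    rw [← LinearMap.adjoint_inner_right, ← LinearMap.comp_apply,
      hT.apply_eigenvectorBasis rfl j, inner_smul_right]
    rfl
  refine ⟨e, fun i j hij => ?_, ?_⟩
  · rw [hin, e.orthonormal.2 hij, mul_zero]
  · have hnorm : ∀ i : Fin (Module.finrank ℝ E), T.singularValues i = ‖T (e i)‖ := by
      intro i
      have h := hin i i
      rw [real_inner_self_eq_norm_sq, real_inner_self_eq_norm_sq, e.orthonormal.1 i, one_pow,
        mul_one] at h
      rw [T.singularValues_fin rfl, ← h, Real.sqrt_sq (norm_nonneg _)]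
    have hsub : T.singularValues.support ⊆ Finset.range (Module.finrank ℝ E) := by
      rw [T.support_singularValues]
      exact Finset.range_subset_range.2 (LinearMap.finrank_range_le T)
    rw [Finsupp.sum_of_support_subset _ hsub _ (fun _ _ => rfl), Finset.sum_range]
    exact Finset.sum_congr rfl fun i _ => hnorm i

/-- Every point has a supporting linear functional for the sum of the singular values, the pairing
with the partial isometry of the polar decomposition. -/
theorem exists_supporting_singularValues (T : E →ₗ[ℝ] F) :
    ∃ l : (E →ₗ[ℝ] F) →ₗ[ℝ] ℝ, l T = T.singularValues.sum (fun _ σ => σ) ∧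
      ∀ S, l S ≤ S.singularValues.sum (fun _ σ => σ) := by
  obtain ⟨e, he, hsum⟩ := exists_orthonormalBasis_singularValues T
  -- the left singular vectors, with `0` in place of those of vanishing singular values
  set f : Fin (Module.finrank ℝ E) → F := fun i => ‖T (e i)‖⁻¹ • T (e i) with hf
  have hfo : ∀ i j, i ≠ j → ⟪f i, f j⟫ = 0 := by
    intro i j hij
    simp [hf, inner_smul_left, inner_smul_right, he i j hij]
  have hfn : ∀ i, ⟪f i, f i⟫ ≤ 1 := by
    intro i
    rw [real_inner_self_eq_norm_sq, hf]
    simp only [norm_smul, norm_inv, norm_norm]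
    rcases eq_or_ne ‖T (e i)‖ 0 with h | h
    · simp [h]
    · rw [inv_mul_cancel₀ h]; norm_num
  have hcomb : ∀ a : Fin (Module.finrank ℝ E) → ℝ, ‖∑ i, a i • f i‖ ^ 2 ≤ ∑ i, a i ^ 2 := by
    intro a
    rw [← real_inner_self_eq_norm_sq, sum_inner]
    refine Finset.sum_le_sum fun i _ => ?_
    rw [inner_sum, Finset.sum_eq_single i]
    · rw [inner_smul_left, inner_smul_right]
      have := mul_le_mul_of_nonneg_left (hfn i) (sq_nonneg (a i))
      simp only [conj_trivial]
      linarith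
    · intro j _ hj
      rw [inner_smul_left, inner_smul_right, hfo i j hj.symm]
      simp
    · simp
  refine ⟨{ toFun := fun S : E →ₗ[ℝ] F => ∑ i, ⟪S (e i), f i⟫
            map_add' := fun S S' => by
              simp [inner_add_left, Finset.sum_add_distrib]
            map_smul' := fun r S => by simp [inner_smul_left, Finset.mul_sum] },
    ?_, fun S => ?_⟩
  · rw [hsum]
    change ∑ i, ⟪T (e i), f i⟫ = _
    refine Finset.sum_congr rfl fun i _ => ?_
    rw [hf, inner_smul_right, real_inner_self_eq_norm_sq]
    rcases eq_or_ne ‖T (e i)‖ 0 with h | h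
    · simp [h]
    · field_simp
  · obtain ⟨h, -, hsumS⟩ := exists_orthonormalBasis_singularValues S
    rw [hsumS]
    have hS : ∀ i, S (e i) = ∑ j, ⟪h j, e i⟫ • S (h j) := by
      intro i
      conv_lhs => rw [← h.sum_repr' (e i)]
      simp
    calc ∑ i, ⟪S (e i), f i⟫ = ∑ i, ∑ j, ⟪S (h j), ⟪h j, e i⟫ • f i⟫ := by
          refine Finset.sum_congr rfl fun i _ => ?_
          rw [hS i, sum_inner]
          simp [inner_smul_left, inner_smul_right]
      _ = ∑ j, ⟪S (h j), ∑ i, ⟪h j, e i⟫ • f i⟫ := by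
          rw [Finset.sum_comm]
          simp [inner_sum]
      _ ≤ ∑ j, ‖S (h j)‖ := by
          refine Finset.sum_le_sum fun j _ => ?_
          refine (real_inner_le_norm _ _).trans (mul_le_of_le_one_right (norm_nonneg _) ?_)
          have h1 := hcomb fun i => ⟪h j, e i⟫
          have h2 : ∑ i, ⟪h j, e i⟫ ^ 2 = 1 := by
            have := e.sum_sq_norm_inner_left (h j)
            simp only [Real.norm_eq_abs, sq_abs] at this
            rw [this, h.orthonormal.1 j]; norm_num
          rw [h2] at h1
          exact (sq_le_one_iff₀ (norm_nonneg _)).1 h1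

end SingularValues

theorem nuclearNorm_nonneg {m n : Type*} [Fintype m] [Fintype n] [DecidableEq n]
    (A : Matrix m n ℝ) : 0 ≤ nuclearNorm A :=
  Finset.sum_nonneg fun i _ => LinearMap.singularValues_nonneg _ i

theorem convexOn_nuclearNorm {m n : Type*} [Fintype m] [Fintype n] [DecidableEq n] :
    ConvexOn ℝ univ (nuclearNorm : Matrix m n ℝ → ℝ) := by
  refine ⟨convex_univ, fun A _ B _ a b ha hb _ => ?_⟩
  obtain ⟨l, hl, hle⟩ := exists_supporting_singularValues (Matrix.toEuclideanLin (a • A + b • B))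
  have hA := mul_le_mul_of_nonneg_left (hle (Matrix.toEuclideanLin A)) ha
  have hB := mul_le_mul_of_nonneg_left (hle (Matrix.toEuclideanLin B)) hb
  simp only [nuclearNorm, smul_eq_mul]
  rw [← hl]
  simp only [map_add, map_smul, smul_eq_mul]
  exact add_le_add hA hB

namespace Problem

variable {N : ℕ} {I : Fin N → ℕ} {n c p : ℕ} (P : Problem I n c p)

theorem coupledNorm_nonneg (ξ : Feat n c) : 0 ≤ P.coupledNorm ξ :=
  nuclearNorm_nonneg _

theorem convexOn_coupledNorm : ConvexOn ℝ univ P.coupledNorm := by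
  refine ⟨convex_univ, fun ξ _ ζ _ a b ha hb hab => ?_⟩
  have h := convexOn_nuclearNorm.2
    (mem_univ (Matrix.fromCols P.unfolding (Matrix.of fun i j => ξ (i, j))))
    (mem_univ (Matrix.fromCols P.unfolding (Matrix.of fun i j => ζ (i, j)))) ha hb hab
  have key : a • Matrix.fromCols P.unfolding (Matrix.of fun i j => ξ (i, j))
      + b • Matrix.fromCols P.unfolding (Matrix.of fun i j => ζ (i, j))
      = Matrix.fromCols P.unfolding (Matrix.of fun i j => (a • ξ + b • ζ) (i, j)) := by
    ext i (j | j)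
    · simp [← add_mul, hab]
    · simp
  rw [key] at h
  exact h

theorem continuous_coupledNorm : Continuous P.coupledNorm :=
  continuousOn_univ.1 (P.convexOn_coupledNorm.continuousOn isOpen_univ)

end Problem

/-! ### Calculus of limiting subgradients -/

section Subgradients

variable {E : Type*} [NormedAddCommGroup E] [InnerProductSpace ℝ E]

theorem regularSubdiff_subset_subdiff (f : E → ℝ) (x : E) : regularSubdiff f x ⊆ subdiff f x :=
  fun v hv => ⟨fun _ => x, fun _ => v, fun _ => hv, tendsto_const_nhds, tendsto_const_nhds,
    tendsto_const_nhds⟩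

theorem mem_subdiff_iff {f : E → ℝ} {x v : E} (hf : ContinuousAt f x) :
    v ∈ subdiff f x ↔ ∀ ε > 0, ∃ y, ∃ w ∈ regularSubdiff f y, ‖y - x‖ < ε ∧ ‖w - v‖ < ε := by
  constructor
  · rintro ⟨y, w, hw, hy, -, hwv⟩ ε hε
    obtain ⟨j, h1, h2⟩ := ((Metric.tendsto_nhds.1 hy ε hε).and
      (Metric.tendsto_nhds.1 hwv ε hε)).exists
    rw [dist_eq_norm] at h1 h2
    exact ⟨y j, w j, hw j, h1, h2⟩
  · intro h
    choose y w hw hy hwv using fun j : ℕ => h (1 / ((j : ℝ) + 1)) Nat.one_div_pos_of_nat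
    have hy' : Tendsto y atTop (𝓝 x) := by
      rw [tendsto_iff_norm_sub_tendsto_zero]
      exact squeeze_zero (fun _ => norm_nonneg _) (fun j => (hy j).le)
        tendsto_one_div_add_atTop_nhds_zero_nat
    refine ⟨y, w, hw, hy', hf.tendsto.comp hy', ?_⟩
    rw [tendsto_iff_norm_sub_tendsto_zero]
    exact squeeze_zero (fun _ => norm_nonneg _) (fun j => (hwv j).le)
      tendsto_one_div_add_atTop_nhds_zero_nat

/-- The graph of the limiting subdifferential of a continuous function is closed. -/
theorem mem_subdiff_of_tendsto {f : E → ℝ} (hf : Continuous f) {u w : ℕ → E} {x v : E}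
    (hw : ∀ᶠ j in atTop, w j ∈ subdiff f (u j)) (hu : Tendsto u atTop (𝓝 x))
    (hwv : Tendsto w atTop (𝓝 v)) : v ∈ subdiff f x := by
  rw [mem_subdiff_iff hf.continuousAt]
  intro ε hε
  obtain ⟨j, hj, h1, h2⟩ := (hw.and ((Metric.tendsto_nhds.1 hu (ε / 2) (half_pos hε)).and
    (Metric.tendsto_nhds.1 hwv (ε / 2) (half_pos hε)))).exists
  rw [dist_eq_norm] at h1 h2
  obtain ⟨y, w', hw', h3, h4⟩ := (mem_subdiff_iff hf.continuousAt).1 hj (ε / 2) (half_pos hε)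
  refine ⟨y, w', hw', ?_, ?_⟩
  · have := norm_sub_le_norm_sub_add_norm_sub y (u j) x
    linarith
  · have := norm_sub_le_norm_sub_add_norm_sub w' (w j) v
    linarith

/-- Fermat's rule for a radial perturbation: if `f + ψ(‖· - x‖²)` has a local minimum at `z`, then
minus the gradient of the perturbation at `z` is a regular subgradient of `f`. -/
theorem smul_sub_mem_regularSubdiff_of_isLocalMin {f : E → ℝ} {ψ : ℝ → ℝ} {x z : E} {d : ℝ}
    (hmin : IsLocalMin (fun y => f y + ψ (‖y - x‖ ^ 2)) z)
    (hψ : HasDerivAt ψ d (‖z - x‖ ^ 2)) : (-(2 * d)) • (z - x) ∈ regularSubdiff f z := by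
  intro ε hε
  have h1 : HasFDerivAt (fun y => ψ (‖y - x‖ ^ 2)) _ z :=
    hψ.comp_hasFDerivAt z (((hasFDerivAt_id z).sub_const x).norm_sq)
  filter_upwards [hmin, h1.isLittleO.def hε] with y hy1 hy2
  have hy3 := (abs_le.1 hy2).2
  simp [inner_sub_left, inner_smul_left] at hy3 hy1 ⊢
  linarith

/-- If `φ + K ‖· - x‖` has a local minimum at `x`, then `φ` has regular subgradients at points
near `x` whose norm is at most about `K`. They are found at the minimizers of
`φ + K √(‖· - x‖² + s) + ‖· - x‖²` as `s → 0`. -/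
theorem exists_regularSubdiff_of_isLocalMin [FiniteDimensional ℝ E] {φ : E → ℝ}
    (hφ : Continuous φ) {K : ℝ} (hK : 0 ≤ K) {x : E}
    (hmin : IsLocalMin (fun y => φ y + K * ‖y - x‖) x) {ε : ℝ} (hε : 0 < ε) :
    ∃ z, ‖z - x‖ < ε ∧ ∃ v ∈ regularSubdiff φ z, ‖v‖ ≤ K + ε := by
  obtain ⟨δ, hδ, hball⟩ := Metric.eventually_nhds_iff.1 hmin
  set r := min (δ / 2) (ε / 2) with hr
  have hr0 : 0 < r := lt_min (half_pos hδ) (half_pos hε)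
  have hrδ : r < δ := (min_le_left _ _).trans_lt (half_lt_self hδ)
  have hrε : r ≤ ε / 2 := min_le_right _ _
  -- a smoothing parameter `s = a²` with `K √s < r²`
  set a := r ^ 2 / (K + 1) with ha
  have ha0 : 0 < a := by positivity
  have hKa : K * a < r ^ 2 := by
    rw [ha, mul_div_assoc', div_lt_iff₀ (by positivity)]
    nlinarith [sq_pos_of_pos hr0]
  set ψ : ℝ → ℝ := fun t => K * √(t + a ^ 2) + t with hψ
  have hcont : Continuous fun z => φ z + ψ (‖z - x‖ ^ 2) := by
    rw [hψ]; fun_prop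
  obtain ⟨z, hz, hzmin⟩ := (isCompact_closedBall x r).exists_isMinOn
    ⟨x, Metric.mem_closedBall_self hr0.le⟩ hcont.continuousOn
  have hzr : ‖z - x‖ ≤ r := by rwa [mem_closedBall_iff_norm] at hz
  have h1 : φ z + ψ (‖z - x‖ ^ 2) ≤ φ x + K * a := by
    have := hzmin (Metric.mem_closedBall_self hr0.le)
    simpa [hψ, Real.sqrt_sq ha0.le] using this
  have h2 : φ x ≤ φ z + K * ‖z - x‖ := by
    have := hball (y := z) (by rw [dist_eq_norm]; linarith)
    simpa using this
  have hsq : ‖z - x‖ ≤ √(‖z - x‖ ^ 2 + a ^ 2) := Real.le_sqrt_of_sq_le (by nlinarith)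
  have h3 : ‖z - x‖ < r := by
    have := mul_le_mul_of_nonneg_left hsq hK
    refine lt_of_pow_lt_pow_left₀ 2 hr0.le ?_
    simp only [hψ] at h1
    linarith
  have hloc : IsLocalMin (fun z => φ z + ψ (‖z - x‖ ^ 2)) z :=
    hzmin.isLocalMin (Metric.closedBall_mem_nhds_of_mem (by rwa [mem_ball_iff_norm]))
  have hpos : 0 < ‖z - x‖ ^ 2 + a ^ 2 := by positivity
  have hder : HasDerivAt ψ (K * (1 / (2 * √(‖z - x‖ ^ 2 + a ^ 2))) + 1) (‖z - x‖ ^ 2) :=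
    ((((hasDerivAt_id (‖z - x‖ ^ 2)).add_const (a ^ 2)).sqrt hpos.ne').const_mul K).add
      (hasDerivAt_id (‖z - x‖ ^ 2))
  refine ⟨z, by linarith, _, smul_sub_mem_regularSubdiff_of_isLocalMin hloc hder, ?_⟩
  have hs : 0 < √(‖z - x‖ ^ 2 + a ^ 2) := Real.sqrt_pos.2 hpos
  have h4 : K * (‖z - x‖ / √(‖z - x‖ ^ 2 + a ^ 2)) ≤ K :=
    mul_le_of_le_one_right hK ((div_le_one hs).2 hsq)
  rw [norm_smul, Real.norm_eq_abs, abs_neg, abs_of_nonneg (by positivity)]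
  calc 2 * (K * (1 / (2 * √(‖z - x‖ ^ 2 + a ^ 2))) + 1) * ‖z - x‖
      = K * (‖z - x‖ / √(‖z - x‖ ^ 2 + a ^ 2)) + 2 * ‖z - x‖ := by field_simp
    _ ≤ K + ε := by linarith

/-- A consequence of the sum rule: at a critical point of `φ + g` with `g` Lipschitz with
constant `K`, the function `φ` has a limiting subgradient of norm at most `K`. -/
theorem exists_subdiff_norm_le_of_isCritical_add [FiniteDimensional ℝ E] {φ g : E → ℝ}
    (hφ : Continuous φ) {K r : ℝ} (hK : 0 ≤ K) (hr : 0 < r) {x : E}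
    (hg : ∀ y z, ‖y - x‖ < r → ‖z - x‖ < r → |g z - g y| ≤ K * ‖z - y‖)
    (h : IsCritical (fun y => φ y + g y) x) : ∃ v ∈ subdiff φ x, ‖v‖ ≤ K := by
  obtain ⟨y, w, hw, hy, -, hw0⟩ := h
  have key : ∀ ε > 0, ∃ z, ∃ v ∈ regularSubdiff φ z, ‖z - x‖ < ε ∧ ‖v‖ ≤ K + ε := by
    intro ε hε
    set δ := min (ε / 3) r with hδ
    have hδ0 : 0 < δ := lt_min (by positivity) hr
    have hδε : δ ≤ ε / 3 := min_le_left _ _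
    obtain ⟨j, h1, h2⟩ := ((Metric.tendsto_nhds.1 hy δ hδ0).and
      (Metric.tendsto_nhds.1 hw0 δ hδ0)).exists
    rw [dist_eq_norm] at h1
    rw [dist_zero_right] at h2
    have h1r : ‖y j - x‖ < r := h1.trans_le (min_le_right _ _)
    have hev : ∀ᶠ z in 𝓝 (y j), ‖z - x‖ < r :=
      (isOpen_lt (by fun_prop) continuous_const).mem_nhds h1r
    have hloc : IsLocalMin (fun z => φ z + (K + 2 * δ) * ‖z - y j‖) (y j) := by
      filter_upwards [hev, hw j δ hδ0] with z hz hz'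
      have h3 := (abs_le.1 (hg (y j) z h1r hz)).2
      have h4 := (abs_le.1 (abs_real_inner_le_norm (w j) (z - y j))).1
      have h5 := mul_le_mul_of_nonneg_right h2.le (norm_nonneg (z - y j))
      simp only [sub_self, norm_zero, mul_zero, add_zero]
      linarith
    obtain ⟨z, hz, v, hv, hvn⟩ :=
      exists_regularSubdiff_of_isLocalMin hφ (by positivity) hloc hδ0
    refine ⟨z, v, hv, ?_, by linarith⟩
    have := norm_sub_le_norm_sub_add_norm_sub z (y j) x
    linarith
  choose z v hv hz hvn using fun j : ℕ => key (1 / ((j : ℝ) + 1)) Nat.one_div_pos_of_nat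
  have hbound : ∀ j, v j ∈ Metric.closedBall (0 : E) (K + 1) := by
    intro j
    rw [mem_closedBall_zero_iff]
    refine (hvn j).trans ?_
    have : 1 / ((j : ℝ) + 1) ≤ 1 := by
      rw [div_le_one (by positivity)]
      linarith [(Nat.cast_nonneg j : (0 : ℝ) ≤ j)]
    linarith
  obtain ⟨v', -, κ, hκ, hlim⟩ := (isCompact_closedBall (0 : E) (K + 1)).tendsto_subseq hbound
  have h0 : Tendsto (fun j => 1 / ((κ j : ℝ) + 1)) atTop (𝓝 0) :=
    tendsto_one_div_add_atTop_nhds_zero_nat.comp hκ.tendsto_atTop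
  refine ⟨v', mem_subdiff_of_tendsto hφ (u := z ∘ κ)
    (Eventually.of_forall fun j => regularSubdiff_subset_subdiff _ _ (hv (κ j))) ?_ hlim, ?_⟩
  · rw [tendsto_iff_norm_sub_tendsto_zero]
    exact squeeze_zero (fun _ => norm_nonneg _) (fun j => (hz (κ j)).le) h0
  · have h1 : Tendsto (fun j => K + 1 / ((κ j : ℝ) + 1)) atTop (𝓝 (K + 0)) := h0.const_add K
    rw [add_zero] at h1
    exact le_of_tendsto_of_tendsto' hlim.norm h1 fun j => hvn (κ j)

/-- One-sided Lipschitz estimate behind `exists_lipschitz_of_regularSubdiff_bounded`. Were it to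
fail, a minimizer of `f + ρ' ‖· - y‖ + M ‖· - y‖²` other than `y` would carry a regular subgradient
of norm at least `ρ' > ρ`. -/
theorem exists_le_add_mul_of_regularSubdiff_bounded [FiniteDimensional ℝ E] {f : E → ℝ}
    (hf : Continuous f) {ρ : ℝ} (hρ : ∀ x, ∀ v ∈ regularSubdiff f x, ‖v‖ ≤ ρ) (R : ℝ) :
    ∃ C ≥ 0, ∀ y, ‖y‖ ≤ R → ∀ z, ‖z - y‖ ≤ 1 → f y ≤ f z + C * ‖z - y‖ := by
  obtain ⟨B, hB⟩ := (isCompact_closedBall (0 : E) (R + 1)).exists_bound_of_continuousOn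
    hf.continuousOn
  set ρ' := |ρ| + 1 with hρ'
  have hρ'0 : 0 < ρ' := by positivity
  have hρρ' : ρ < ρ' := by linarith [le_abs_self ρ]
  set M := 2 * |B| + 1 with hM
  have hM0 : 0 < M := by positivity
  refine ⟨ρ' + M, by positivity, fun y hy z hz => ?_⟩
  have hBy : ∀ z, ‖z - y‖ ≤ 1 → |f z| ≤ |B| := by
    intro z hz
    refine (hB z ?_).trans (le_abs_self B)
    rw [mem_closedBall_zero_iff]
    have := norm_le_norm_add_norm_sub' z y
    linarith
  set ψ : ℝ → ℝ := fun t => ρ' * √t + M * t with hψ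
  have hψn : ∀ z, ψ (‖z - y‖ ^ 2) = ρ' * ‖z - y‖ + M * ‖z - y‖ ^ 2 := by
    intro z
    simp only [hψ, Real.sqrt_sq (norm_nonneg _)]
  have hcont : Continuous fun z => f z + ψ (‖z - y‖ ^ 2) := by
    rw [hψ]; fun_prop
  have hymem : y ∈ Metric.closedBall y 1 := Metric.mem_closedBall_self zero_le_one
  obtain ⟨z₀, hz₀, hmin⟩ := (isCompact_closedBall y 1).exists_isMinOn ⟨y, hymem⟩ hcont.continuousOn
  rw [mem_closedBall_iff_norm] at hz₀
  have h1 : f z₀ + ψ (‖z₀ - y‖ ^ 2) ≤ f y := by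
    simpa [hψ] using hmin hymem
  rw [hψn] at h1
  have hlt : ‖z₀ - y‖ < 1 := by
    refine lt_of_le_of_ne hz₀ fun h => ?_
    have h2 := (abs_le.1 (hBy z₀ hz₀)).1
    have h3 := (abs_le.1 (hBy y (by simp))).2
    rw [h] at h1
    linarith
  have heq : z₀ = y := by
    by_contra hne
    have ht : 0 < ‖z₀ - y‖ := norm_pos_iff.2 (sub_ne_zero.2 hne)
    have hloc : IsLocalMin (fun z => f z + ψ (‖z - y‖ ^ 2)) z₀ :=
      hmin.isLocalMin (Metric.closedBall_mem_nhds_of_mem (by rwa [mem_ball_iff_norm]))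
    have hder : HasDerivAt ψ (ρ' * (1 / (2 * √(‖z₀ - y‖ ^ 2))) + M * 1) (‖z₀ - y‖ ^ 2) :=
      (((hasDerivAt_id (‖z₀ - y‖ ^ 2)).sqrt (pow_pos ht 2).ne').const_mul ρ').add
        ((hasDerivAt_id (‖z₀ - y‖ ^ 2)).const_mul M)
    have h2 := hρ _ _ (smul_sub_mem_regularSubdiff_of_isLocalMin hloc hder)
    rw [norm_smul, Real.norm_eq_abs, abs_neg, abs_of_nonneg (by positivity),
      Real.sqrt_sq ht.le] at h2
    have h3 : 2 * (ρ' * (1 / (2 * ‖z₀ - y‖)) + M * 1) * ‖z₀ - y‖ = ρ' + 2 * M * ‖z₀ - y‖ := by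
      field_simp
    rw [h3] at h2
    have : 0 < 2 * M * ‖z₀ - y‖ := by positivity
    linarith
  have h4 := hmin (mem_closedBall_iff_norm.2 hz)
  simp only [mem_ofPred_eq, hψn, heq] at h4
  simp only [sub_self, norm_zero] at h4
  have h5 : ‖z - y‖ ^ 2 ≤ ‖z - y‖ := by
    rw [sq]; exact mul_le_of_le_one_left (norm_nonneg _) hz
  have h6 := mul_le_mul_of_nonneg_left h5 hM0.le
  linarith

/-- A continuous function whose regular subgradients are bounded is Lipschitz on bounded sets, here
in the form of a uniform estimate for pairs of points at distance at most `1`. -/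
theorem exists_lipschitz_of_regularSubdiff_bounded [FiniteDimensional ℝ E] {f : E → ℝ}
    (hf : Continuous f) {ρ : ℝ} (hρ : ∀ x, ∀ v ∈ regularSubdiff f x, ‖v‖ ≤ ρ) (R : ℝ) :
    ∃ C ≥ 0, ∀ y z, ‖y‖ ≤ R → ‖z‖ ≤ R → ‖z - y‖ ≤ 1 → |f z - f y| ≤ C * ‖z - y‖ := by
  obtain ⟨C, hC, h⟩ := exists_le_add_mul_of_regularSubdiff_bounded hf hρ R
  refine ⟨C, hC, fun y z hy hz hzy => abs_le.2 ⟨?_, ?_⟩⟩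
  · linarith [h y hy z hzy]
  · have := h z hz y (by rwa [norm_sub_rev])
    rw [norm_sub_rev] at this
    linarith

end Subgradients

/-! ### Descent sequences of Kurdyka–Łojasiewicz functions -/

namespace IsDesingularizing

variable {η ζ s t : ℝ} {φ χ : ℝ → ℝ}

theorem differentiableAt (hφ : IsDesingularizing η φ) (hs : s ∈ Ioo 0 η) :
    DifferentiableAt ℝ φ s :=
  ((hφ.contDiffOn.differentiableOn one_ne_zero) s hs).differentiableAt (isOpen_Ioo.mem_nhds hs)

theorem mono (hφ : IsDesingularizing η φ) (h : ζ ≤ η) : IsDesingularizing ζ φ where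
  map_zero := hφ.map_zero
  continuousOn := hφ.continuousOn.mono (Ico_subset_Ico_right h)
  concaveOn := hφ.concaveOn.subset (Ico_subset_Ico_right h) (convex_Ico 0 ζ)
  contDiffOn := hφ.contDiffOn.mono (Ioo_subset_Ioo_right h)
  deriv_pos s hs := hφ.deriv_pos s (Ioo_subset_Ioo_right h hs)

theorem deriv_add (hφ : IsDesingularizing η φ) (hχ : IsDesingularizing η χ) (hs : s ∈ Ioo 0 η) :
    deriv (φ + χ) s = deriv φ s + deriv χ s :=
  _root_.deriv_add (hφ.differentiableAt hs) (hχ.differentiableAt hs)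

protected theorem add (hφ : IsDesingularizing η φ) (hχ : IsDesingularizing η χ) :
    IsDesingularizing η (φ + χ) where
  map_zero := by simp [hφ.map_zero, hχ.map_zero]
  continuousOn := hφ.continuousOn.add hχ.continuousOn
  concaveOn := hφ.concaveOn.add hχ.concaveOn
  contDiffOn := hφ.contDiffOn.add hχ.contDiffOn
  deriv_pos s hs := by
    rw [hφ.deriv_add hχ hs]
    exact add_pos (hφ.deriv_pos s hs) (hχ.deriv_pos s hs)

protected theorem id : IsDesingularizing 1 (fun s : ℝ => s) where
  map_zero := rfl
  continuousOn := continuousOn_id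
  concaveOn := concaveOn_id (convex_Ico 0 1)
  contDiffOn := contDiffOn_id
  deriv_pos s _ := by simp

theorem deriv_mul_sub_le (hφ : IsDesingularizing η φ) (ht : 0 ≤ t) (hts : t ≤ s) (hs : 0 < s)
    (hsη : s < η) : deriv φ s * (s - t) ≤ φ s - φ t := by
  rcases hts.eq_or_lt with rfl | hlt
  · simp
  · have h := hφ.concaveOn.deriv_le_slope ⟨ht, hlt.trans hsη⟩ ⟨hs.le, hsη⟩ hlt
      (hφ.differentiableAt ⟨hs, hsη⟩)
    rwa [slope_def_field, le_div_iff₀ (sub_pos.2 hlt)] at h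

theorem nonneg (hφ : IsDesingularizing η φ) (hs : 0 ≤ s) (hsη : s < η) : 0 ≤ φ s := by
  rcases hs.eq_or_lt with rfl | hpos
  · exact hφ.map_zero.ge
  · have h := hφ.deriv_mul_sub_le le_rfl hs hpos hsη
    rw [hφ.map_zero, sub_zero, sub_zero] at h
    exact (mul_pos (hφ.deriv_pos s ⟨hpos, hsη⟩) hpos).le.trans h

end IsDesingularizing

/-- If `aₖ₊₁` is at most the mean of `aₖ` and the decrement of a nonnegative sequence `b`, then `a`
is summable: `aₖ₊₁` is at most the decrement of `a + b`. -/
theorem summable_of_two_mul_le_add_sub {a b : ℕ → ℝ} (ha : ∀ k, 0 ≤ a k) {m : ℕ}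
    (hb : ∀ k ≥ m, 0 ≤ b k) (h : ∀ k ≥ m, 2 * a (k + 1) ≤ a k + (b k - b (k + 1))) :
    Summable a := by
  rw [← summable_nat_add_iff (m + 1)]
  refine summable_of_sum_range_le (c := a m + b m) (fun k => ha _) fun n => ?_
  have key : ∀ n, ∑ i ∈ Finset.range n, a (i + (m + 1)) ≤
      (a m + b m) - (a (n + m) + b (n + m)) := by
    intro n
    induction n with
    | zero => simp
    | succ n ih =>
      rw [Finset.sum_range_succ]
      have h1 := h (n + m) (Nat.le_add_left _ _)
      rw [show n + 1 + m = n + m + 1 by ring, show n + (m + 1) = n + m + 1 by ring]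
      linarith
  have h1 := hb (n + m) (Nat.le_add_left _ _)
  linarith [key n, ha (n + m)]

section Descent

variable {E : Type*} [NormedAddCommGroup E] [InnerProductSpace ℝ E] {h : E → ℝ} {u : ℕ → E}
  {a : ℕ → ℝ} {α C : ℝ}

theorem isCritical_of_tendsto_subseq (hh : Continuous h) (ha : Tendsto a atTop (𝓝 0))
    (hsub : ∀ k, ∃ v ∈ subdiff h (u (k + 1)), ‖v‖ ≤ C * a k) {κ : ℕ → ℕ} (hκ : StrictMono κ)
    {x : E} (hx : Tendsto (u ∘ κ) atTop (𝓝 x)) : IsCritical h x := by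
  choose v hv hvn using hsub
  have hpred : Tendsto (fun j => κ j - 1) atTop atTop :=
    (tendsto_sub_atTop_nat 1).comp hκ.tendsto_atTop
  refine mem_subdiff_of_tendsto hh (w := fun j => v (κ j - 1)) ?_ hx ?_
  · filter_upwards [hκ.tendsto_atTop.eventually_ge_atTop 1] with j hj
    have := hv (κ j - 1)
    rwa [Nat.sub_add_cancel hj] at this
  · have h1 : Tendsto (fun k => C * a k) atTop (𝓝 0) := by simpa using ha.const_mul C
    exact (squeeze_zero_norm hvn h1).comp hpred

/-- The sequence of values of a descent sequence converges, and its step sizes tend to `0`. -/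
theorem exists_tendsto_of_descent {E : Type*} [NormedAddCommGroup E] [ProperSpace E] {h : E → ℝ}
    {u : ℕ → E} (hh : Continuous h) (hu : Bornology.IsBounded (range u))
    (hα : 0 < α) (hdec : ∀ k, h (u (k + 1)) + α * a k ^ 2 ≤ h (u k)) :
    Antitone (fun k => h (u k)) ∧ ∃ H, Tendsto (fun k => h (u k)) atTop (𝓝 H) ∧
      Tendsto a atTop (𝓝 0) := by
  have hanti : Antitone fun k => h (u k) := antitone_nat_of_succ_le fun k => by
    have : 0 ≤ α * a k ^ 2 := by positivity
    linarith [hdec k]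
  have hbdd : BddBelow (range fun k => h (u k)) := by
    refine (hu.isCompact_closure.bddBelow_image hh.continuousOn).mono ?_
    rintro _ ⟨k, rfl⟩
    exact ⟨u k, subset_closure ⟨k, rfl⟩, rfl⟩
  refine ⟨hanti, _, tendsto_atTop_ciInf hanti hbdd, ?_⟩
  have hlim := tendsto_atTop_ciInf hanti hbdd
  have hdiff : Tendsto (fun k => (h (u k) - h (u (k + 1))) / α) atTop (𝓝 0) := by
    have := (hlim.sub (hlim.comp (tendsto_add_atTop_nat 1))).div_const α
    simpa using this
  have hsq : Tendsto (fun k => a k ^ 2) atTop (𝓝 0) := by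
    refine squeeze_zero (fun k => sq_nonneg _) (fun k => ?_) hdiff
    rw [le_div_iff₀ hα]
    linarith [hdec k]
  have habs := hsq.sqrt
  simp only [Real.sqrt_sq_eq_abs, Real.sqrt_zero] at habs
  exact (tendsto_zero_iff_abs_tendsto_zero a).2 habs

/-- The Kurdyka–Łojasiewicz inequality holds along the whole tail of a bounded descent sequence with
one desingularizing function. Points of the compact closure of the sequence that are not cluster
points have neighbourhoods that the tail avoids; the others are critical, with the limiting value,
and the finitely many desingularizing functions needed are added up. -/
theorem exists_isDesingularizing_of_descent [ProperSpace E] (hh : Continuous h)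
    (hKL : KLProperty h) (hu : Bornology.IsBounded (range u)) {H : ℝ}
    (hH : Tendsto (fun k => h (u k)) atTop (𝓝 H))
    (hcrit : ∀ x (κ : ℕ → ℕ), StrictMono κ → Tendsto (u ∘ κ) atTop (𝓝 x) → IsCritical h x) :
    ∃ η > 0, ∃ φ : ℝ → ℝ, IsDesingularizing η φ ∧
      ∀ᶠ k in atTop, H < h (u k) → h (u k) < H + η →
        ∀ v ∈ subdiff h (u k), 1 ≤ deriv φ (h (u k) - H) * ‖v‖ := by
  let p : Set E → Prop := fun S => ∃ η > 0, ∃ φ : ℝ → ℝ, IsDesingularizing η φ ∧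
      ∀ᶠ k in atTop, u k ∈ S → H < h (u k) → h (u k) < H + η →
        ∀ v ∈ subdiff h (u k), 1 ≤ deriv φ (h (u k) - H) * ‖v‖
  have hp : p (closure (range u)) := by
    refine hu.isCompact_closure.induction_on (p := p) ?_ ?_ ?_ ?_
    · exact ⟨1, one_pos, _, IsDesingularizing.id, Eventually.of_forall fun k hk => hk.elim⟩
    · rintro S T hST ⟨η, hη, φ, hφ, hev⟩
      exact ⟨η, hη, φ, hφ, hev.mono fun k hk hkS => hk (hST hkS)⟩
    · rintro S T ⟨η, hη, φ, hφ, hev⟩ ⟨ζ, hζ, χ, hχ, hev'⟩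
      have hφ' := hφ.mono (min_le_left η ζ)
      have hχ' := hχ.mono (min_le_right η ζ)
      refine ⟨min η ζ, lt_min hη hζ, φ + χ, hφ'.add hχ', ?_⟩
      filter_upwards [hev, hev'] with k hk hk' hkST h1 h2 v hv
      have hmem : h (u k) - H ∈ Ioo 0 (min η ζ) := ⟨by linarith, by linarith⟩
      rw [hφ'.deriv_add hχ' hmem, add_mul]
      have h3 := mul_nonneg (hφ'.deriv_pos _ hmem).le (norm_nonneg v)
      have h4 := mul_nonneg (hχ'.deriv_pos _ hmem).le (norm_nonneg v)
      rcases hkST with hkS | hkT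
      · linarith [hk hkS h1 (h2.trans_le (by gcongr; exact min_le_left _ _)) v hv]
      · linarith [hk' hkT h1 (h2.trans_le (by gcongr; exact min_le_right _ _)) v hv]
    · intro x _
      by_cases hx : MapClusterPt x atTop u
      · obtain ⟨κ, hκ, hlim⟩ := hx.tendsto_subseq
        have hHx : h x = H := tendsto_nhds_unique ((hh.tendsto x).comp hlim)
          (hH.comp hκ.tendsto_atTop)
        obtain ⟨η, hη, φ, hφ, hev⟩ := hKL x ⟨0, hcrit x κ hκ hlim⟩
        refine ⟨_, mem_nhdsWithin_of_mem_nhds hev, η, hη, φ, hφ, Eventually.of_forall fun k hk => ?_⟩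
        rw [← hHx]
        exact hk
      · rw [mapClusterPt_iff_frequently] at hx
        push Not at hx
        obtain ⟨t, ht, hev⟩ := hx
        exact ⟨t, mem_nhdsWithin_of_mem_nhds ht, 1, one_pos, _, IsDesingularizing.id,
          hev.mono fun k hk hkt => (hk hkt).elim⟩
  obtain ⟨η, hη, φ, hφ, hev⟩ := hp
  exact ⟨η, hη, φ, hφ, hev.mono fun k hk => hk (subset_closure ⟨k, rfl⟩)⟩

/-- Finite length of the steps of a bounded descent sequence. The step sizes `a k` are only required
to control the decrease of the values and the subgradients, not the distance of the iterates. -/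
theorem summable_of_descent [ProperSpace E] (hh : Continuous h) (hKL : KLProperty h)
    (hu : Bornology.IsBounded (range u)) (ha : ∀ k, 0 ≤ a k) (hα : 0 < α) (hC : 0 ≤ C)
    (hdec : ∀ k, h (u (k + 1)) + α * a k ^ 2 ≤ h (u k))
    (hsub : ∀ k, ∃ v ∈ subdiff h (u (k + 1)), ‖v‖ ≤ C * a k) : Summable a := by
  obtain ⟨hanti, H, hH, ha0⟩ := exists_tendsto_of_descent hh hu hα hdec
  obtain ⟨η, hη, φ, hφ, hev⟩ := exists_isDesingularizing_of_descent hh hKL hu hH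
    fun x κ hκ hx => isCritical_of_tendsto_subseq hh ha0 hsub hκ hx
  obtain ⟨m, hm⟩ := eventually_atTop.1 (hev.and (hH.eventually_lt_const (lt_add_of_pos_right H hη)))
  have hge : ∀ k, H ≤ h (u k) := fun k => hanti.le_of_tendsto hH k
  have hφ0 : ∀ k ≥ m, 0 ≤ φ (h (u k) - H) := fun k hk =>
    hφ.nonneg (sub_nonneg.2 (hge k)) (by linarith [(hm k hk).2])
  refine summable_of_two_mul_le_add_sub ha (m := m) (b := fun k => C / α * φ (h (u (k + 1)) - H))
    (fun k hk => mul_nonneg (by positivity) (hφ0 (k + 1) (by omega))) fun k hk => ?_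
  set r := h (u (k + 1)) - H with hr
  set r' := h (u (k + 1 + 1)) - H with hr'
  have hr0 : 0 ≤ r := sub_nonneg.2 (hge _)
  have hr'0 : 0 ≤ r' := sub_nonneg.2 (hge _)
  have hstep : α * a (k + 1) ^ 2 ≤ r - r' := by linarith [hdec (k + 1)]
  rcases hr0.eq_or_lt with h0 | hpos
  · -- the values have reached their limit, so that the next step vanishes
    have hsq : 0 ≤ α * a (k + 1) ^ 2 := by positivity
    have h1 : a (k + 1) ^ 2 = 0 := by
      have : α * a (k + 1) ^ 2 = 0 := by linarith
      exact (mul_eq_zero.1 this).resolve_left hα.ne'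
    have h2 : r' = 0 := by linarith
    rw [pow_eq_zero_iff two_ne_zero] at h1
    rw [h1, ← h0, h2]
    linarith [ha k]
  · have hrη : r < η := by linarith [(hm (k + 1) (by omega)).2]
    have hd := hφ.deriv_pos r ⟨hpos, hrη⟩
    obtain ⟨v, hv, hvn⟩ := hsub k
    have h1 := (hm (k + 1) (by omega)).1 (by linarith) (by linarith) v hv
    have h2 : 1 ≤ deriv φ r * (C * a k) := h1.trans (mul_le_mul_of_nonneg_left hvn hd.le)
    have hanti' : r' ≤ r := by
      have : 0 ≤ α * a (k + 1) ^ 2 := by positivity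
      linarith
    have h3 := hφ.deriv_mul_sub_le hr'0 hanti' hpos hrη
    have h4 := mul_le_mul_of_nonneg_left hstep hd.le
    have h5 : a (k + 1) ^ 2 ≤ a k * (C / α * (φ r - φ r')) := by
      calc a (k + 1) ^ 2 ≤ a (k + 1) ^ 2 * (deriv φ r * (C * a k)) :=
            le_mul_of_one_le_right (sq_nonneg _) h2
        _ = C / α * a k * (deriv φ r * (α * a (k + 1) ^ 2)) := by field_simp
        _ ≤ C / α * a k * (φ r - φ r') :=
            mul_le_mul_of_nonneg_left (h4.trans h3) (mul_nonneg (by positivity) (ha k))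
        _ = a k * (C / α * (φ r - φ r')) := by ring
    have h6 : 0 ≤ C / α * (φ r - φ r') := by
      refine mul_nonneg (by positivity) (le_trans ?_ h3)
      exact mul_nonneg hd.le (by linarith)
    -- the inequality between the arithmetic and the geometric mean
    have h7 : 2 * a (k + 1) ≤ a k + C / α * (φ r - φ r') := by
      refine le_of_sq_le_sq ?_ (add_nonneg (ha k) h6)
      nlinarith [sq_nonneg (a k - C / α * (φ r - φ r'))]
    linarith

end Descent

/-! ### The alternating minimization method -/

namespace Problem

variable {N : ℕ} {I : Fin N → ℕ} {n c p : ℕ} (P : Problem I n c p)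

theorem continuous_thetaObjective (hf : Continuous P.features) (hL : Continuous P.empiricalLoss)
    (ξ : Feat n c) : Continuous (P.thetaObjective ξ) := by
  unfold thetaObjective
  fun_prop

theorem continuous_objective (hf : Continuous P.features) (hL : Continuous P.empiricalLoss) :
    Continuous P.objective := by
  have h := P.continuous_coupledNorm
  unfold objective
  fun_prop

theorem objective_toLp (θ : Params p) (ξ : Feat n c) :
    P.objective (WithLp.toLp 2 (θ, ξ)) = P.empiricalLoss θ + P.lam * P.coupledNorm ξ
      + P.mu / 2 * ‖P.features θ - ξ‖ ^ 2 := rfl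

theorem exists_lipschitz_features (hf : Continuous P.features)
    (hsub : ∃ ρ > 0, ∀ (i : Fin n) (j : Fin c) (θ : Params p),
      ∀ g ∈ subdiff (fun τ => P.features τ (i, j)) θ, ‖g‖ ≤ ρ) (R : ℝ) :
    ∃ C ≥ 0, ∀ y z, ‖y‖ ≤ R → ‖z‖ ≤ R → ‖z - y‖ ≤ 1 →
      ‖P.features z - P.features y‖ ≤ C * ‖z - y‖ := by
  obtain ⟨ρ, -, hρ⟩ := hsub
  have hcomp : ∀ ij : Fin n × Fin c, ∃ C ≥ 0, ∀ y z : Params p, ‖y‖ ≤ R → ‖z‖ ≤ R → ‖z - y‖ ≤ 1 →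
      |P.features z ij - P.features y ij| ≤ C * ‖z - y‖ := fun ij =>
    exists_lipschitz_of_regularSubdiff_bounded (f := fun τ => P.features τ ij)
      ((EuclideanSpace.proj ij).continuous.comp hf)
      (fun θ v hv => hρ ij.1 ij.2 θ v (regularSubdiff_subset_subdiff _ _ hv)) R
  choose C hC hlip using hcomp
  refine ⟨∑ ij, C ij, Finset.sum_nonneg fun ij _ => hC ij, fun y z hy hz hzy => ?_⟩
  set d := P.features z - P.features y with hd
  have hsum : d = ∑ ij, EuclideanSpace.single ij (d ij) := by
    ext kl
    simp [Finset.sum_apply, Pi.single_apply]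
  calc ‖d‖ = ‖∑ ij, EuclideanSpace.single ij (d ij)‖ := by rw [← hsum]
    _ ≤ ∑ ij, ‖EuclideanSpace.single ij (d ij)‖ := norm_sum_le _ _
    _ ≤ ∑ ij, C ij * ‖z - y‖ := by
        refine Finset.sum_le_sum fun ij _ => ?_
        rw [PiLp.norm_single]
        exact hlip ij y z hy hz hzy
    _ = (∑ ij, C ij) * ‖z - y‖ := by rw [Finset.sum_mul]

/-- The objective splits into its two partial functions and a bilinear coupling term. -/
theorem objective_sub_objective (θ θ' : Params p) (ξ ξ' : Feat n c) :
    P.objective (WithLp.toLp 2 (θ', ξ')) - P.objective (WithLp.toLp 2 (θ, ξ)) =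
      (P.thetaObjective ξ θ' - P.thetaObjective ξ θ) + (P.xiObjective θ ξ' - P.xiObjective θ ξ)
        - P.mu * ⟪P.features θ' - P.features θ, ξ' - ξ⟫ := by
  simp only [objective_toLp, thetaObjective, xiObjective, norm_sub_sq_real, inner_sub_left,
    inner_sub_right]
  ring

/-- Partial regular subgradients assemble into a joint one. Where the features are Lipschitz, the
coupling term is of second order, although it is not differentiable. -/
theorem toLp_mem_regularSubdiff_objective (hmu : 0 < P.mu) {θ v : Params p} {ξ w : Feat n c} {C : ℝ}
    (hlip : ∀ᶠ y in 𝓝 θ, ‖P.features y - P.features θ‖ ≤ C * ‖y - θ‖)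
    (hv : v ∈ regularSubdiff (P.thetaObjective ξ) θ)
    (hw : w ∈ regularSubdiff (P.xiObjective θ) ξ) :
    WithLp.toLp 2 (v, w) ∈ regularSubdiff P.objective (WithLp.toLp 2 (θ, ξ)) := by
  intro ε hε
  have hfst : Tendsto (fun u : Joint p n c => u.fst) (𝓝 (WithLp.toLp 2 (θ, ξ))) (𝓝 θ) :=
    Continuous.tendsto' (by fun_prop) _ _ rfl
  have hsnd : Tendsto (fun u : Joint p n c => u.snd) (𝓝 (WithLp.toLp 2 (θ, ξ))) (𝓝 ξ) :=
    Continuous.tendsto' (by fun_prop) _ _ rfl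
  have hsmall : ∀ᶠ ζ in 𝓝 ξ, P.mu * C * ‖ζ - ξ‖ < ε / 3 := by
    have : Tendsto (fun ζ : Feat n c => P.mu * C * ‖ζ - ξ‖) (𝓝 ξ) (𝓝 0) :=
      Continuous.tendsto' (by fun_prop) _ _ (by simp)
    exact this.eventually_lt_const (by positivity)
  filter_upwards [hfst.eventually hlip, hfst.eventually (hv (ε / 3) (by positivity)),
    hsnd.eventually (hw (ε / 3) (by positivity)), hsnd.eventually hsmall] with u h1 h2 h3 h4
  have hnorm : ‖u - WithLp.toLp 2 (θ, ξ)‖ ^ 2 = ‖u.fst - θ‖ ^ 2 + ‖u.snd - ξ‖ ^ 2 := by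
    rw [WithLp.prod_norm_sq_eq_of_L2]; rfl
  have hn1 : ‖u.fst - θ‖ ≤ ‖u - WithLp.toLp 2 (θ, ξ)‖ :=
    le_of_sq_le_sq (by nlinarith [sq_nonneg ‖u.snd - ξ‖]) (norm_nonneg _)
  have hn2 : ‖u.snd - ξ‖ ≤ ‖u - WithLp.toLp 2 (θ, ξ)‖ :=
    le_of_sq_le_sq (by nlinarith [sq_nonneg ‖u.fst - θ‖]) (norm_nonneg _)
  have hinner : ⟪WithLp.toLp 2 (v, w), u - WithLp.toLp 2 (θ, ξ)⟫ =
      ⟪v, u.fst - θ⟫ + ⟪w, u.snd - ξ⟫ := by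
    rw [WithLp.prod_inner_apply]; rfl
  have hobj := P.objective_sub_objective θ u.fst ξ u.snd
  have hcoup : P.mu * ⟪P.features u.fst - P.features θ, u.snd - ξ⟫ ≤ ε / 3 * ‖u.fst - θ‖ := by
    calc P.mu * ⟪P.features u.fst - P.features θ, u.snd - ξ⟫
        ≤ P.mu * (C * ‖u.fst - θ‖ * ‖u.snd - ξ‖) := by
          refine mul_le_mul_of_nonneg_left ((real_inner_le_norm _ _).trans ?_) hmu.le
          exact mul_le_mul_of_nonneg_right h1 (norm_nonneg _)
      _ = P.mu * C * ‖u.snd - ξ‖ * ‖u.fst - θ‖ := by ring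
      _ ≤ ε / 3 * ‖u.fst - θ‖ := mul_le_mul_of_nonneg_right h4.le (norm_nonneg _)
  have e1 := mul_le_mul_of_nonneg_left hn1 (show 0 ≤ ε / 3 by positivity)
  have e2 := mul_le_mul_of_nonneg_left hn2 (show 0 ≤ ε / 3 by positivity)
  rw [hinner]
  change P.objective u - _ = _ at hobj
  linarith

theorem toLp_mem_subdiff_objective (hmu : 0 < P.mu) (hf : Continuous P.features)
    (hL : Continuous P.empiricalLoss) {θ v : Params p} {ξ : Feat n c}
    (hlip : ∀ τ, ∃ C, ∀ᶠ y in 𝓝 τ, ‖P.features y - P.features τ‖ ≤ C * ‖y - τ‖)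
    (hv : v ∈ subdiff (P.thetaObjective ξ) θ)
    (hξ : ∀ ζ, P.xiObjective θ ξ ≤ P.xiObjective θ ζ) :
    WithLp.toLp 2 (v, 0) ∈ subdiff P.objective (WithLp.toLp 2 (θ, ξ)) := by
  obtain ⟨y, w, hw, hy, -, hwv⟩ := hv
  -- the change of the partial gradient in `ξ` between `θ` and the nearby point `y j`
  set z : ℕ → Feat n c := fun j => (-P.mu) • (P.features (y j) - P.features θ) with hz
  have hzmem : ∀ j, z j ∈ regularSubdiff (P.xiObjective (y j)) ξ := by
    intro j ε hε
    refine Eventually.of_forall fun ζ => ?_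
    have h1 : P.xiObjective (y j) ζ - P.xiObjective (y j) ξ =
        P.xiObjective θ ζ - P.xiObjective θ ξ + ⟪z j, ζ - ξ⟫ := by
      simp only [hz, xiObjective, norm_sub_sq_real, inner_sub_left, inner_sub_right,
        inner_smul_left, conj_trivial]
      ring
    have h2 : 0 ≤ ε * ‖ζ - ξ‖ := mul_nonneg (le_of_lt hε) (norm_nonneg _)
    linarith [hξ ζ]
  have hz0 : Tendsto z atTop (𝓝 0) := by
    have := (((hf.tendsto θ).comp hy).sub_const (P.features θ)).const_smul (-P.mu)
    simpa [hz] using this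
  have hpair : ∀ {a : ℕ → Params p} {b : ℕ → Feat n c} {a' b'}, Tendsto a atTop (𝓝 a') →
      Tendsto b atTop (𝓝 b') → Tendsto (fun j => (WithLp.toLp 2 (a j, b j) : Joint p n c)) atTop
        (𝓝 (WithLp.toLp 2 (a', b'))) := fun ha hb =>
    ((WithLp.prod_continuous_toLp 2 _ _).tendsto _).comp (ha.prodMk_nhds hb)
  refine mem_subdiff_of_tendsto (P.continuous_objective hf hL)
    (u := fun j => WithLp.toLp 2 (y j, ξ)) (w := fun j => WithLp.toLp 2 (w j, z j))
    (Eventually.of_forall fun j => ?_) (hpair hy tendsto_const_nhds) (hpair hwv hz0)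
  obtain ⟨C, hlipj⟩ := hlip (y j)
  exact regularSubdiff_subset_subdiff _ _
    (P.toLp_mem_regularSubdiff_objective hmu hlipj (hw j) (hzmem j))

/-- Quadratic growth of the strongly convex `ξ`-subproblem at its minimizer, from a comparison with
the midpoint. -/
theorem xiObjective_add_le (hlam : 0 < P.lam) {θ : Params p} {ξ : Feat n c}
    (hξ : ∀ ζ, P.xiObjective θ ξ ≤ P.xiObjective θ ζ) (ζ : Feat n c) :
    P.xiObjective θ ξ + P.mu / 4 * ‖ξ - ζ‖ ^ 2 ≤ P.xiObjective θ ζ := by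
  have h1 := P.convexOn_coupledNorm.2 (mem_univ ξ) (mem_univ ζ)
    one_half_pos.le one_half_pos.le (add_halves 1)
  have h2 := hξ ((1 / 2 : ℝ) • ξ + (1 / 2 : ℝ) • ζ)
  have h3 := mul_le_mul_of_nonneg_left h1 hlam.le
  have h4 : ‖P.features θ - ((1 / 2 : ℝ) • ξ + (1 / 2 : ℝ) • ζ)‖ ^ 2 =
      1 / 2 * ‖P.features θ - ξ‖ ^ 2 + 1 / 2 * ‖P.features θ - ζ‖ ^ 2 - 1 / 4 * ‖ξ - ζ‖ ^ 2 := by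
    simp only [← real_inner_self_eq_norm_sq, inner_sub_left, inner_sub_right, inner_add_left,
      inner_add_right, real_inner_smul_left, real_inner_smul_right,
      real_inner_comm ξ (P.features θ), real_inner_comm ζ (P.features θ), real_inner_comm ζ ξ]
    ring
  simp only [xiObjective, h4, smul_eq_mul] at h2 h3 ⊢
  linarith

namespace IsAlternatingMinimization

variable {P} {θ : ℕ → Params p} {ξ : ℕ → Feat n c}

theorem objective_succ_add_le (halg : P.IsAlternatingMinimization θ ξ) (hlam : 0 < P.lam) (k : ℕ) :
    P.objective (WithLp.toLp 2 (θ (k + 1), ξ (k + 1))) + P.mu / 4 * ‖ξ (k + 1) - ξ k‖ ^ 2 ≤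
      P.objective (WithLp.toLp 2 (θ k, ξ k)) := by
  have h1 := P.xiObjective_add_le hlam (halg.xi_step k) (ξ k)
  have h2 := (halg.theta_step k).1
  simp only [xiObjective, thetaObjective] at h1 h2
  simp only [objective_toLp]
  linarith

theorem exists_subdiff_norm_le (halg : P.IsAlternatingMinimization θ ξ) (hmu : 0 < P.mu)
    (hf : Continuous P.features) (hL : Continuous P.empiricalLoss)
    (hlip : ∀ R, ∃ C ≥ 0, ∀ y z, ‖y‖ ≤ R → ‖z‖ ≤ R → ‖z - y‖ ≤ 1 →
      ‖P.features z - P.features y‖ ≤ C * ‖z - y‖) (hbdd : Bornology.IsBounded (range θ)) :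
    ∃ C ≥ 0, ∀ k, ∃ v ∈ subdiff P.objective (WithLp.toLp 2 (θ (k + 1), ξ (k + 1))),
      ‖v‖ ≤ C * ‖ξ (k + 1) - ξ k‖ := by
  obtain ⟨R, hR⟩ := hbdd.exists_norm_le
  obtain ⟨C, hC, hCl⟩ := hlip (R + 1)
  have hloc : ∀ τ, ∃ C, ∀ᶠ y in 𝓝 τ, ‖P.features y - P.features τ‖ ≤ C * ‖y - τ‖ := by
    intro τ
    obtain ⟨C, -, hCl⟩ := hlip (‖τ‖ + 1)
    refine ⟨C, ?_⟩
    filter_upwards [Metric.closedBall_mem_nhds τ one_pos] with y hy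
    rw [mem_closedBall_iff_norm] at hy
    refine hCl τ y (by linarith) ?_ hy
    linarith [norm_le_norm_add_norm_sub' y τ]
  refine ⟨P.mu * C, by positivity, fun k => ?_⟩
  -- the objectives of two successive `θ`-subproblems differ by a Lipschitz function
  set g : Params p → ℝ := fun y =>
    P.mu / 2 * ‖P.features y - ξ k‖ ^ 2 - P.mu / 2 * ‖P.features y - ξ (k + 1)‖ ^ 2 with hg
  have hcrit : IsCritical (fun y => P.thetaObjective (ξ (k + 1)) y + g y) (θ (k + 1)) := by
    have h := (halg.theta_step k).2
    have heq : P.thetaObjective (ξ k) = fun y => P.thetaObjective (ξ (k + 1)) y + g y := by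
      funext y
      simp only [thetaObjective, hg]
      ring
    rwa [heq] at h
  have hglip : ∀ y z, ‖y - θ (k + 1)‖ < 1 / 2 → ‖z - θ (k + 1)‖ < 1 / 2 →
      |g z - g y| ≤ P.mu * C * ‖ξ (k + 1) - ξ k‖ * ‖z - y‖ := by
    intro y z hy hz
    have hθ := hR _ (mem_range_self (k + 1))
    have h1 := hCl y z (by linarith [norm_le_norm_add_norm_sub' y (θ (k + 1))])
      (by linarith [norm_le_norm_add_norm_sub' z (θ (k + 1))]) (by
        have := norm_sub_le_norm_sub_add_norm_sub z (θ (k + 1)) y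
        rw [norm_sub_rev (θ (k + 1)) y] at this
        linarith)
    have h2 : g z - g y = P.mu * ⟪P.features z - P.features y, ξ (k + 1) - ξ k⟫ := by
      simp only [hg, norm_sub_sq_real, inner_sub_left, inner_sub_right]
      ring
    rw [h2, abs_mul, abs_of_pos hmu]
    calc P.mu * |⟪P.features z - P.features y, ξ (k + 1) - ξ k⟫|
        ≤ P.mu * (C * ‖z - y‖ * ‖ξ (k + 1) - ξ k‖) := by
          refine mul_le_mul_of_nonneg_left ((abs_real_inner_le_norm _ _).trans ?_) hmu.le
          exact mul_le_mul_of_nonneg_right h1 (norm_nonneg _)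
      _ = P.mu * C * ‖ξ (k + 1) - ξ k‖ * ‖z - y‖ := by ring
  obtain ⟨v, hv, hvn⟩ := exists_subdiff_norm_le_of_isCritical_add
    (P.continuous_thetaObjective hf hL (ξ (k + 1))) (by positivity) one_half_pos hglip hcrit
  refine ⟨_, P.toLp_mem_subdiff_objective hmu hf hL hloc hv (halg.xi_step k), ?_⟩
  rwa [WithLp.norm_toLp_fst]

/-- The iterates are bounded: comparison with `ζ = 0` in the `ξ`-subproblem bounds
`‖f_θ(𝒳) - ξ‖`, and the features are bounded along a bounded sequence of parameters. -/
theorem isBounded_range (halg : P.IsAlternatingMinimization θ ξ) (hlam : 0 < P.lam)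
    (hmu : 0 < P.mu) (hf : Continuous P.features) (hbdd : Bornology.IsBounded (range θ)) :
    Bornology.IsBounded (range fun k => (WithLp.toLp 2 (θ k, ξ k) : Joint p n c)) := by
  obtain ⟨R, hR⟩ := hbdd.exists_norm_le
  obtain ⟨B, hB⟩ := hbdd.isCompact_closure.exists_bound_of_continuousOn hf.continuousOn
  have hF : ∀ k, ‖P.features (θ k)‖ ≤ B := fun k => hB _ (subset_closure (mem_range_self k))
  set D := P.lam * P.coupledNorm 0 + P.mu / 2 * B ^ 2 with hD
  have hξ : ∀ k, ‖ξ (k + 1)‖ ≤ B + √(2 / P.mu * D) := by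
    intro k
    have h1 := halg.xi_step k 0
    simp only [xiObjective, sub_zero] at h1
    have h2 : P.mu / 2 * ‖P.features (θ (k + 1))‖ ^ 2 ≤ P.mu / 2 * B ^ 2 := by
      have := hF (k + 1)
      gcongr
    have h3 := mul_nonneg hlam.le (P.coupledNorm_nonneg (ξ (k + 1)))
    have h4 : ‖P.features (θ (k + 1)) - ξ (k + 1)‖ ≤ √(2 / P.mu * D) := by
      refine Real.le_sqrt_of_sq_le ?_
      have h5 : P.mu / 2 * ‖P.features (θ (k + 1)) - ξ (k + 1)‖ ^ 2 ≤ D := by linarith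
      rw [div_mul_eq_mul_div, le_div_iff₀ hmu]
      linarith
    rw [norm_sub_rev] at h4
    linarith [norm_le_norm_add_norm_sub' (ξ (k + 1)) (P.features (θ (k + 1))), hF (k + 1)]
  have hξb : Bornology.IsBounded (range ξ) := by
    rw [isBounded_iff_forall_norm_le]
    refine ⟨max ‖ξ 0‖ (B + √(2 / P.mu * D)), ?_⟩
    rintro _ ⟨k, rfl⟩
    cases k with
    | zero => exact le_max_left _ _
    | succ k => exact (hξ k).trans (le_max_right _ _)
  refine ((hbdd.isCompact_closure.prod hξb.isCompact_closure).image
    (WithLp.prod_continuous_toLp 2 _ _)).isBounded.subset ?_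
  rintro _ ⟨k, rfl⟩
  exact ⟨(θ k, ξ k), ⟨subset_closure ⟨k, rfl⟩, subset_closure ⟨k, rfl⟩⟩, rfl⟩

end IsAlternatingMinimization

end Problem

end CoupledNorm

theorem mainTheorem1 {N : ℕ} {I : Fin N → ℕ} {n c p : ℕ}
    (P : CoupledNorm.Problem I n c p)
    (hlam : 0 < P.lam) (hmu : 0 < P.mu)
    (hf : Continuous P.features) (hL : Continuous P.empiricalLoss)
    (hreg : ∀ u, CoupledNorm.RegularAt P.objective u)
    (hKL : CoupledNorm.KLProperty P.objective)
    (hsub : ∃ ρ > 0, ∀ (i : Fin n) (j : Fin c) (θ : CoupledNorm.Params p),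
      ∀ g ∈ CoupledNorm.subdiff (fun τ => P.features τ (i, j)) θ, ‖g‖ ≤ ρ)
    (θ : ℕ → CoupledNorm.Params p) (ξ : ℕ → CoupledNorm.Feat n c)
    (halg : P.IsAlternatingMinimization θ ξ)
    (hbdd : Bornology.IsBounded (Set.range θ)) :
    Summable (fun k => ‖ξ (k + 1) - ξ k‖) ∧
    ∃ ξs : CoupledNorm.Feat n c, Filter.Tendsto ξ Filter.atTop (nhds ξs) ∧
      ∀ θs : CoupledNorm.Params p,
        (∃ κ : ℕ → ℕ, StrictMono κ ∧ Filter.Tendsto (θ ∘ κ) Filter.atTop (nhds θs)) →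
        CoupledNorm.IsCritical P.objective (WithLp.toLp 2 (θs, ξs)) := by
  have hcont := P.continuous_objective hf hL
  obtain ⟨C, hC, hgrad⟩ := halg.exists_subdiff_norm_le hmu hf hL
    (P.exists_lipschitz_features hf hsub) hbdd
  have hsum : Summable fun k => ‖ξ (k + 1) - ξ k‖ :=
    CoupledNorm.summable_of_descent (u := fun k => WithLp.toLp 2 (θ k, ξ k)) hcont hKL
      (halg.isBounded_range hlam hmu hf hbdd) (fun _ => norm_nonneg _)
      (show 0 < P.mu / 4 by positivity) hC (halg.objective_succ_add_le hlam) hgrad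
  refine ⟨hsum, ?_⟩
  have hcauchy : CauchySeq ξ := cauchySeq_of_summable_dist <| by
    simpa only [dist_eq_norm, norm_sub_rev, Nat.succ_eq_add_one] using hsum
  obtain ⟨ξs, hξs⟩ := cauchySeq_tendsto_of_complete hcauchy
  refine ⟨ξs, hξs, ?_⟩
  rintro θs ⟨κ, hκ, hθs⟩
  exact CoupledNorm.isCritical_of_tendsto_subseq (u := fun k => WithLp.toLp 2 (θ k, ξ k)) hcont
    hsum.tendsto_atTop_zero hgrad hκ
    (((WithLp.prod_continuous_toLp 2 _ _).tendsto _).comp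
      (hθs.prodMk_nhds (hξs.comp hκ.tendsto_atTop)))
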